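/- Conventions. An algebraic type is fixed, formulas are terms over a countably infinite set $Var$ of variables, and $Fm$ is the set of formulas (the absolutely free algebra). A logic $\mathcal{L}$ is a closure operator $C_{\mathcal{L}}$ on $\mathcal{P}(Fm)$ that is structural, i.e. $\sigma[C_{\mathcal{L}}(\Gamma)]\subseteq C_{\mathcal{L}}(\sigma[\Gamma])$ for every substitution $\sigma$; $\Gamma\vdash_{\mathcal{L}}\varphi$ means $\varphi\in C_{\mathcal{L}}(\Gamma)$. A rule is $\Gamma\vdash\varphi$ with $\Gamma$ finite; $\Gamma\dashv\vdash\Gamma'$ stands for all rules $\Gamma\vdash\varphi$ ($\varphi\in\Gamma'$) and $\Gamma'\vdash\psi$ ($\psi\in\Gamma$). A Hilbert calculus is a set of rules and determines the logic of derivability by means of substitution instances of its rules. For an algebra $A$ and $F\subseteq A$, the Leibniz congruence $\Omega^A F$ is the largest congruence $\theta$ of $A$ compatible with $F$ (i.e. $\langle a,b\rangle\in\theta$ and $a\in F$ imply $b\in F$). $F$ is a filter of $\mathcal{L}$ on $A$ if $\Gamma\vdash_{\mathcal{L}}\varphi$ and $h[\Gamma]\subseteq F$ imply $h(\varphi)\in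 F$ for every homomorphism $h\colon Fm\to A$. $\mathrm{Mod}^*\mathcal{L}$ is the class of pairs $\langle A,F\rangle$ with $F$ a filter of $\mathcal{L}$ on $A$ and $\Omega^A F$ the identity. The logic $\mathcal{L}$ is *protoalgebraic* if there is a set of formulas $\rho(x,y,\vec z)$ such that, for every algebra $A$, every filter $F$ of $\mathcal{L}$ on $A$ and all $a,b\in A$: $\langle a,b\rangle\in\Omega^A F$ if and only if $\rho^A(a,b,\vec c)\subseteq F$ for all $\vec c$ in $A$. It is *equivalential* if this holds with some $\rho(x,y)$ without parameters $\vec z$, which is then called a set of congruence formulas. It is *truth-equational* if there is a set $\tau(x)$ of equations in one variable with $F=\{a\in A: A\vDash\tau(a)\}$ for all $\langle A,F\rangle\in\mathrm{Mod}^*\mathcal{L}$. *Truth is implicitly definable* in $\mathrm{Mod}^*\mathcal{L}$ if $\langle A,F\rangle,\langle A,G\rangle\in\mathrm{Mod}^*\mathcal{L}$ implies $F=G$. $\mathcal{L}$ is *assertional* if there is a class $K$ of algebras with a constant term $1$ such that $\Gamma\vdash_{\mathcal{L}}\varphi$ if and only if, for every $A\in K$ and homomorphism $h\colon Fm\to A$,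 $h[\Gamma]\subseteq\{1\}$ implies $h(\varphi)=1$. $\mathcal{L}$ is *finitely regularly algebraizable* if it is assertional, equivalential and truth-equational, and has a finite set of congruence formulas. Let $p(z_1,\dots,z_n)$ be a term in the language $+,\cdot,-,0,1$ of commutative rings, let $x,y$ be distinct variables different from $z_1,\dots,z_n$, and let $\mathcal{L}(p)$ be the logic, in the language of commutative rings expanded with a binary operation symbol $\leftrightarrow$, determined by the following finite Hilbert calculus (in the rules in which $p$ does not occur, $x,y,z,u,w$ are any distinct variables): $$\emptyset\vdash x\leftrightarrow x,\qquad x\leftrightarrow y\vdash y\leftrightarrow x,\qquad x\leftrightarrow y,\ y\leftrightarrow z\vdash x\leftrightarrow z,\qquad x\leftrightarrow y\vdash -x\leftrightarrow -y,$$ $$x\leftrightarrow y,\ z\leftrightarrow u\vdash (x\ast z)\leftrightarrow(y\ast u)\quad\text{for each }\ast\in\{+,\cdot,\leftrightarrow\},$$ $$p\leftrightarrow 0,\ x,\ x\leftrightarrow y\vdash y,\qquad p\leftrightarrow 0,\ x\ \dashv\vdash\ x\leftrightarrow(x\leftrightarrow x),\ p\leftrightarrow 0,\qquad p\leftrightarrow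 0,\ x,\ y\vdash x\leftrightarrow y,$$ together with $\emptyset\vdash\alpha\leftrightarrow\beta$ for each of the following pairs $(\alpha,\beta)$: for $C(t)=w+(u\cdot t)$, the pairs $(C(s),C(t))$ with $(s,t)$ one of $((x\cdot y)\cdot z,\ x\cdot(y\cdot z))$, $(x\cdot y,\ y\cdot x)$, $(x\cdot 1,\ x)$, $((x+y)+z,\ x+(y+z))$, $(x+y,\ y+x)$, $(x+0,\ x)$, $(x+-x,\ 0)$, $(x\cdot(y+z),\ (x\cdot y)+(x\cdot z))$, $(-(x+y),\ -x+-y)$, $(-(x\cdot y),\ -x\cdot y)$, $(-(x\cdot y),\ x\cdot -y)$; and the pairs $(0+x,\ x)$ and $(x+(1\cdot y),\ x+y)$. **Theorem.** For every $n\ge 0$ and every term $p(z_1,\dots,z_n)$ in the language of commutative rings, the following are equivalent: (i) $\mathcal{L}(p)$ is finitely regularly algebraizable; (ii) truth is implicitly definable in $\mathrm{Mod}^*\mathcal{L}(p)$; (iii) $\mathcal{L}(p)$ is protoalgebraic; (iv) the equation $p(z_1,\dots,z_n)\approx 0$ has an integer solution. -/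

import Mathlib

namespace AAL

open FirstOrder FirstOrder.Language

/-! ### Algebras, congruences, Leibniz congruence

An algebraic type is a first-order language `L`, of which only the function symbols matter;
an algebra is an `L`-structure. -/

/-- `θ` is a congruence: an equivalence relation compatible with all basic operations. -/
def IsCongruence (L : FirstOrder.Language.{0, 0}) {A : Type*} [L.Structure A] (θ : Setoid A) : Prop :=
  ∀ (n : ℕ) (f : L.Functions n) (a b : Fin n → A), (∀ i, θ (a i) (b i)) →
    θ (Structure.funMap f a) (Structure.funMap f b)

/-- `θ` is compatible with the set `F`. -/
def Compatible {A : Type*} (θ : Setoid A) (F : Set A) : Prop :=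
  ∀ a b, θ a b → a ∈ F → b ∈ F

/-- The Leibniz congruence of `F`, the largest congruence compatible with `F`
(see `leibniz_isGreatest`). -/
def leibniz (L : FirstOrder.Language.{0, 0}) {A : Type*} [L.Structure A] (F : Set A) : Setoid A :=
  sSup {θ | IsCongruence L θ ∧ Compatible θ F}

theorem leibniz_isGreatest (L : FirstOrder.Language.{0, 0}) {A : Type*} [L.Structure A] (F : Set A) :
    IsGreatest {θ : Setoid A | IsCongruence L θ ∧ Compatible θ F} (leibniz L F) := by
  classical
  refine ⟨⟨?_, ?_⟩, fun θ hθ => le_sSup hθ⟩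
  · intro n f a b hab
    -- one coordinate at a time
    have step : ∀ (c : Fin n → A) (i : Fin n) (x y : A), leibniz L F x y →
        leibniz L F (Structure.funMap f (Function.update c i x))
          (Structure.funMap f (Function.update c i y)) := by
      intro c i x y hxy
      rw [leibniz, Setoid.sSup_eq_eqvGen] at hxy
      induction hxy with
      | rel x y h =>
        obtain ⟨θ, hθ, hxy⟩ := h
        refine (le_sSup hθ : θ ≤ leibniz L F) (hθ.1 n f _ _ fun j => ?_)
        by_cases hj : j = i
        · subst hj; simp only [Function.update_self]; exact hxy
        · simpa [hj] using θ.refl (c j)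
      | refl x => exact (leibniz L F).refl _
      | symm x y _ ih => exact (leibniz L F).symm ih
      | trans x y z _ _ ih₁ ih₂ => exact (leibniz L F).trans ih₁ ih₂
    have key : ∀ s : Finset (Fin n),
        leibniz L F (Structure.funMap f a) (Structure.funMap f (s.piecewise b a)) := by
      intro s
      induction s using Finset.induction_on with
      | empty => rw [Finset.piecewise_empty]
      | insert i s hi ih =>
        refine (leibniz L F).trans ih ?_
        have h := step (s.piecewise b a) i (a i) (b i) (hab i)
        rw [Finset.piecewise_insert]
        have e : Function.update (s.piecewise b a) i (a i) = s.piecewise b a := by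
          rw [Function.update_eq_self_iff]; simp [hi]
        rwa [e] at h
    simpa using key Finset.univ
  · intro a b hab
    rw [leibniz, Setoid.sSup_eq_eqvGen] at hab
    have : a ∈ F ↔ b ∈ F := by
      induction hab with
      | rel x y h =>
        obtain ⟨θ, hθ, hxy⟩ := h
        exact ⟨hθ.2 _ _ hxy, hθ.2 _ _ (θ.symm hxy)⟩
      | refl x => exact Iff.rfl
      | symm x y _ ih => exact ih.symm
      | trans x y z _ _ ih₁ ih₂ => exact ih₁.trans ih₂
    exact this.1

/-! ### Logics and Hilbert calculi

Formulas are terms over the countable set `ℕ` of variables. A substitution is determined by a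
map `ℕ → L.Term ℕ`, and a homomorphism from the formula algebra to `A` by an assignment
`v : ℕ → A` (the homomorphism is `Term.realize v`). -/

/-- A logic: a structural closure operator on the set of formulas. -/
structure Logic (L : FirstOrder.Language.{0, 0}) where
  C : ClosureOperator (Set (L.Term ℕ))
  structural : ∀ (σ : ℕ → L.Term ℕ) (Γ : Set (L.Term ℕ)),
    (fun φ => φ.subst σ) '' C Γ ⊆ C ((fun φ => φ.subst σ) '' Γ)

/-- A rule `Γ ⊢ φ` with `Γ` finite. -/
@[ext] structure Rule (L : FirstOrder.Language.{0, 0}) where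
  premises : Finset (L.Term ℕ)
  conclusion : L.Term ℕ

/-- A Hilbert calculus is a set of rules. -/
abbrev HilbertCalculus (L : FirstOrder.Language.{0, 0}) := Set (Rule L)

/-- `Derives H Γ φ`: there is a proof of `φ` from the premises `Γ` using substitution instances of
the rules in `H`. -/
inductive Derives {L : FirstOrder.Language.{0, 0}} (H : HilbertCalculus L) (Γ : Set (L.Term ℕ)) :
    L.Term ℕ → Prop
  | premise (φ : L.Term ℕ) : φ ∈ Γ → Derives H Γ φ
  | rule (r : Rule L) (σ : ℕ → L.Term ℕ) : r ∈ H →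
      (∀ γ ∈ r.premises, Derives H Γ (γ.subst σ)) → Derives H Γ (r.conclusion.subst σ)

theorem Derives.cut {L : FirstOrder.Language.{0, 0}} {H : HilbertCalculus L} {Γ Δ : Set (L.Term ℕ)}
    {φ : L.Term ℕ} (h : Derives H Δ φ) (hΔ : ∀ δ ∈ Δ, Derives H Γ δ) : Derives H Γ φ := by
  induction h with
  | premise φ hφ => exact hΔ φ hφ
  | rule r σ hr _ ih => exact .rule r σ hr ih

theorem subst_subst {L : FirstOrder.Language.{0, 0}} (t : L.Term ℕ) (σ τ : ℕ → L.Term ℕ) :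
    (t.subst σ).subst τ = t.subst fun i => (σ i).subst τ := by
  induction t with
  | var i => rfl
  | func f ts ih => simp [Term.subst, ih]

theorem Derives.subst {L : FirstOrder.Language.{0, 0}} {H : HilbertCalculus L} {Γ : Set (L.Term ℕ)}
    {φ : L.Term ℕ} (h : Derives H Γ φ) (τ : ℕ → L.Term ℕ) :
    Derives H ((fun φ => φ.subst τ) '' Γ) (φ.subst τ) := by
  induction h with
  | premise φ hφ => exact .premise _ ⟨φ, hφ, rfl⟩
  | rule r σ hr _ ih =>
    rw [subst_subst]
    refine .rule r _ hr fun γ hγ => ?_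
    rw [← subst_subst]
    exact ih γ hγ

/-- The logic determined by a Hilbert calculus. -/
def HilbertCalculus.logic {L : FirstOrder.Language.{0, 0}} (H : HilbertCalculus L) : Logic L where
  C :=
    { toFun := fun Γ => {φ | Derives H Γ φ}
      monotone' := fun _ _ h _ hφ => hφ.cut fun δ hδ => .premise δ (h hδ)
      le_closure' := fun _ φ hφ => .premise φ hφ
      idempotent' := fun _ =>
        Set.Subset.antisymm (fun _ hφ => hφ.cut fun _ hδ => hδ) (fun φ hφ => .premise φ hφ) }
  structural := by
    rintro σ Γ _ ⟨φ, hφ, rfl⟩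
    exact Derives.subst hφ σ

/-! ### Matrix models -/

/-- `F` is a deductive filter of the logic `Λ` over the algebra `A`. -/
def IsFilter {L : FirstOrder.Language.{0, 0}} (Λ : Logic L) {A : Type*} [L.Structure A] (F : Set A) : Prop :=
  ∀ (Γ : Set (L.Term ℕ)) (φ : L.Term ℕ), φ ∈ Λ.C Γ →
    ∀ v : ℕ → A, (∀ γ ∈ Γ, γ.realize v ∈ F) → φ.realize v ∈ F

/-- The matrix `⟨A, F⟩` is a reduced model of the logic `Λ`. -/
def IsReducedModel {L : FirstOrder.Language.{0, 0}} (Λ : Logic L) {A : Type*} [L.Structure A]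
    (F : Set A) : Prop :=
  IsFilter Λ F ∧ leibniz L F = ⊥

/-! ### The classes of the Leibniz hierarchy -/

/-- The logic is protoalgebraic: it has a set `ρ(x, y, z⃗)` of congruence formulas with
parameters. The variables `x, y` are `Sum.inl 0, Sum.inl 1`, the parameters are `Sum.inr k`. -/
def IsProtoalgebraic.{u} {L : FirstOrder.Language.{0, 0}} (Λ : Logic L) : Prop :=
  ∃ ρ : Set (L.Term (Fin 2 ⊕ ℕ)), ∀ (A : Type u) [L.Structure A] (F : Set A), IsFilter Λ F →
    ∀ a b : A, leibniz L F a b ↔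
      ∀ c : ℕ → A, ∀ φ ∈ ρ, φ.realize (Sum.elim ![a, b] c) ∈ F

/-- `ρ(x, y)` is a set of (parameter-free) congruence formulas for the logic. -/
def IsCongruenceFormulas.{u} {L : FirstOrder.Language.{0, 0}} (Λ : Logic L) (ρ : Set (L.Term (Fin 2))) :
    Prop :=
  ∀ (A : Type u) [L.Structure A] (F : Set A), IsFilter Λ F →
    ∀ a b : A, leibniz L F a b ↔ ∀ φ ∈ ρ, φ.realize ![a, b] ∈ F

def IsEquivalential.{u} {L : FirstOrder.Language.{0, 0}} (Λ : Logic L) : Prop :=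
  ∃ ρ : Set (L.Term (Fin 2)), IsCongruenceFormulas.{u} Λ ρ

/-- Truth is equationally definable in the class of reduced models, by a set of equations in
one variable. -/
def IsTruthEquational.{u} {L : FirstOrder.Language.{0, 0}} (Λ : Logic L) : Prop :=
  ∃ τ : Set (L.Term Unit × L.Term Unit),
    ∀ (A : Type u) [L.Structure A] (F : Set A), IsReducedModel Λ F →
      F = {a | ∀ e ∈ τ, e.1.realize (fun _ => a) = e.2.realize (fun _ => a)}

/-- Truth is implicitly definable in the class of reduced models. -/
def TruthImplicitlyDefinable.{u} {L : FirstOrder.Language.{0, 0}} (Λ : Logic L) : Prop :=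
  ∀ (A : Type u) [L.Structure A] (F G : Set A),
    IsReducedModel Λ F → IsReducedModel Λ G → F = G

def IsAlgebraizable.{u} {L : FirstOrder.Language.{0, 0}} (Λ : Logic L) : Prop :=
  IsEquivalential.{u} Λ ∧ IsTruthEquational.{u} Λ

/-- The logic is assertional: it is the logic preserving the value of a term `one` that is
constant on each algebra of a class `K` of algebras. -/
def IsAssertional.{u} {L : FirstOrder.Language.{0, 0}} (Λ : Logic L) : Prop :=
  ∃ (K : Set (CategoryTheory.Bundled.{u} L.Structure)) (one : L.Term ℕ),
    (∀ A ∈ K, ∀ v w : ℕ → A, one.realize v = one.realize w) ∧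
    ∀ (Γ : Set (L.Term ℕ)) (φ : L.Term ℕ), φ ∈ Λ.C Γ ↔
      ∀ A ∈ K, ∀ v : ℕ → A, (∀ γ ∈ Γ, γ.realize v = one.realize v) → φ.realize v = one.realize v

def IsRegularlyAlgebraizable.{u} {L : FirstOrder.Language.{0, 0}} (Λ : Logic L) : Prop :=
  IsAssertional.{u} Λ ∧ IsAlgebraizable.{u} Λ

def IsFinitelyRegularlyAlgebraizable.{u} {L : FirstOrder.Language.{0, 0}} (Λ : Logic L) : Prop :=
  IsRegularlyAlgebraizable.{u} Λ ∧
    ∃ ρ : Set (L.Term (Fin 2)), ρ.Finite ∧ IsCongruenceFormulas.{u} Λ ρ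

/-! ### The calculus associated with a Diophantine equation -/

/-- The pairs `(α, β)` such that the calculus `CR` for commutative rings consists of the rules
`α ⊢ β` and `β ⊢ α`. -/
def crPairs : Set (FirstOrder.Language.ring.Term ℕ × FirstOrder.Language.ring.Term ℕ) :=
  let x : FirstOrder.Language.ring.Term ℕ := Term.var 0
  let y : FirstOrder.Language.ring.Term ℕ := Term.var 1
  let z : FirstOrder.Language.ring.Term ℕ := Term.var 2
  let u : FirstOrder.Language.ring.Term ℕ := Term.var 3
  let w : FirstOrder.Language.ring.Term ℕ := Term.var 4
  { (w + u * ((x * y) * z), w + u * (x * (y * z))),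
    (w + u * (x * y), w + u * (y * x)),
    (w + u * (x * 1), w + u * x),
    (w + u * ((x + y) + z), w + u * (x + (y + z))),
    (w + u * (x + y), w + u * (y + x)),
    (w + u * (x + 0), w + u * x),
    (w + u * (x + -x), w + u * 0),
    (w + u * (x * (y + z)), w + u * ((x * y) + (x * z))),
    (w + u * -(x + y), w + u * (-x + -y)),
    (w + u * -(x * y), w + u * (-x * y)),
    (w + u * -(x * y), w + u * (x * -y)),
    (0 + x, x),
    (x + 1 * y, x + y) }

/-- The function symbols of the type with a single binary operation symbol `↔`. -/
inductive BicondFunc : ℕ → Type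
  | bicond : BicondFunc 2

/-- The language of commutative rings expanded with a binary operation symbol `↔`. -/
abbrev ringBicond : FirstOrder.Language.{0, 0} :=
  FirstOrder.Language.ring.sum ⟨BicondFunc, fun _ => Empty⟩

/-- A term in the language of rings, seen in the expanded language. -/
def ofRing {α : Type} (t : FirstOrder.Language.ring.Term α) : ringBicond.Term α :=
  LHom.sumInl.onTerm t

def tneg {α : Type} (s : ringBicond.Term α) : ringBicond.Term α :=
  Functions.apply₁ (L := ringBicond) (Sum.inl Ring.negFunc) s

def tadd {α : Type} (s t : ringBicond.Term α) : ringBicond.Term α :=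
  Functions.apply₂ (L := ringBicond) (Sum.inl Ring.addFunc) s t

def tmul {α : Type} (s t : ringBicond.Term α) : ringBicond.Term α :=
  Functions.apply₂ (L := ringBicond) (Sum.inl Ring.mulFunc) s t

/-- The term `s ↔ t`. -/
def bic {α : Type} (s t : ringBicond.Term α) : ringBicond.Term α :=
  Functions.apply₂ (L := ringBicond) (Sum.inr BicondFunc.bicond) s t

/-- `Γ ⊣⊢ Δ`: the rules `Γ ⊢ φ` for `φ ∈ Δ` and `Δ ⊢ ψ` for `ψ ∈ Γ`. -/
def biRules {L : FirstOrder.Language.{0, 0}} (Γ Δ : Finset (L.Term ℕ)) : Set (Rule L) :=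
  (fun φ => ⟨Γ, φ⟩) '' (Δ : Set (L.Term ℕ)) ∪ (fun ψ => ⟨Δ, ψ⟩) '' (Γ : Set (L.Term ℕ))

open Classical in
/-- The Hilbert calculus of the Diophantine equation `p(z₁, …, zₙ) ≈ 0`. The variables
`z₁, …, zₙ` of `p` are placed at the variables `2, 3, …` of the formula algebra, so that
`x = 0` and `y = 1` are new. -/
noncomputable def diophantineCalculus {n : ℕ} (p : FirstOrder.Language.ring.Term (Fin n)) :
    HilbertCalculus ringBicond :=
  let x : ringBicond.Term ℕ := Term.var 0
  let y : ringBicond.Term ℕ := Term.var 1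
  let z : ringBicond.Term ℕ := Term.var 2
  let u : ringBicond.Term ℕ := Term.var 3
  let p0 : ringBicond.Term ℕ :=
    bic (ofRing (p.relabel fun i : Fin n => (i : ℕ) + 2)) (ofRing 0)
  { ⟨∅, bic x x⟩,
    ⟨{bic x y}, bic y x⟩,
    ⟨{bic x y, bic y z}, bic x z⟩,
    ⟨{bic x y}, bic (tneg x) (tneg y)⟩,
    ⟨{bic x y, bic z u}, bic (tadd x z) (tadd y u)⟩,
    ⟨{bic x y, bic z u}, bic (tmul x z) (tmul y u)⟩,
    ⟨{bic x y, bic z u}, bic (bic x z) (bic y u)⟩,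
    ⟨{p0, x, bic x y}, y⟩,
    ⟨{p0, x, y}, bic x y⟩ } ∪
  biRules {p0, x} {bic x (bic x x), p0} ∪
  (fun e => ⟨∅, bic (ofRing e.1) (ofRing e.2)⟩) '' crPairs

/-- The calculus is finite. -/
theorem diophantineCalculus_finite {n : ℕ} (p : FirstOrder.Language.ring.Term (Fin n)) :
    (diophantineCalculus p).Finite := by
  unfold diophantineCalculus biRules crPairs
  refine ((Set.toFinite _).union ((Set.Finite.image _ (Finset.finite_toSet _)).union
    (Set.Finite.image _ (Finset.finite_toSet _)))).union (Set.Finite.image _ (Set.toFinite _))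

/-- The logic `L(p)`. -/
noncomputable def diophantineLogic {n : ℕ} (p : FirstOrder.Language.ring.Term (Fin n)) :
    Logic ringBicond :=
  (diophantineCalculus p).logic

/-- The equation `p(z₁, …, zₙ) ≈ 0` has an integer solution. -/
def HasIntegerSolution {n : ℕ} (p : FirstOrder.Language.ring.Term (Fin n)) : Prop :=
  letI := Ring.compatibleRingOfRing ℤ
  ∃ a : Fin n → ℤ, p.realize a = 0

end AAL

universe u

/-!
The formula `x ↔ y` behaves as follows in a model `⟨A, F⟩` of `L(p)`. The relation
`bicCongruence`, that is `a ↔ b ∈ F`, is always a congruence containing the Leibniz congruence of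
`F`, and the rules for `crPairs` make the quotient of `A` by it a commutative ring. Hence an
integer solution of `p ≈ 0` yields elements `c` of `A` with `p(c) ↔ 0 ∈ F`
(`exists_solution_mem`). This activates the rules with premise `p ↔ 0`: `a ↔ b ∈ F` becomes
compatible with `F`, hence equal to the Leibniz congruence (`leibniz_iff_bicOp_mem`), any two
elements of `F` are identified, and `F` is defined by `x ≈ x ↔ x` in reduced models. For
assertionality (`isAssertional_of_hasIntegerSolution`), completeness is witnessed by the quotients
of the formula algebra by interderivability. So solvability makes `L(p)` finitely regularly
algebraizable; for any logic, this implies that it is protoalgebraic and that truth is implicitly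
definable.

If `p ≈ 0` has no integer solution, let `A` be `ℤ × B` with all operations computed on the first
coordinate, where `a ↔ b` has first coordinate `0` if `a` and `b` agree there, and `1` otherwise.
No evaluation of `p ↔ 0` belongs to a set containing the first of these values but not the second,
so that the rules with premise `p ↔ 0` hold vacuously and every such set is a filter
(`isFilter_intProd`). With `B` a point, all of these filters are reduced, so that truth is not
implicitly definable. With `B` a pair of points, enlarging a union of fibres of `A → ℤ` by one
point of another fibre destroys the compatibility of the kernel of `A → ℤ`, so the Leibniz operator
is not monotone on filters and `L(p)` is not protoalgebraic.
-/

namespace AAL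

open FirstOrder FirstOrder.Language

/-! ### Filters, quotients and the formula algebra -/

section General

variable {L : FirstOrder.Language.{0, 0}}

theorem subst_var (t : L.Term ℕ) : t.subst Term.var = t := by
  induction t with
  | var i => rfl
  | func f ts ih => simp [Term.subst, ih]

theorem isFilter_logic_iff {H : HilbertCalculus L} {A : Type*} [L.Structure A] {F : Set A} :
    IsFilter H.logic F ↔ ∀ r ∈ H, ∀ v : ℕ → A,
      (∀ γ ∈ r.premises, γ.realize v ∈ F) → r.conclusion.realize v ∈ F := by
  constructor
  · intro h r hr v hv
    refine h r.premises r.conclusion ?_ v hv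
    have := Derives.rule (H := H) (Γ := r.premises) r Term.var hr fun γ hγ => by
      rw [subst_var]
      exact .premise _ hγ
    rwa [subst_var] at this
  · intro h Γ φ hφ v hv
    change Derives H Γ φ at hφ
    induction hφ with
    | premise φ hφ => exact hv φ hφ
    | rule r σ hr _ ih =>
      rw [Term.realize_subst]
      exact h r hr _ fun γ hγ => by simpa only [Term.realize_subst] using ih γ hγ

/-- The operations of the quotient of an algebra by an equivalence relation, computed on chosen
representatives; they are the expected ones for a congruence (see `realize_quotient`). -/
noncomputable instance quotientAlgebra {A : Type*} [L.Structure A] (θ : Setoid A) :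
    L.Structure (Quotient θ) where
  funMap f xs := Quotient.mk θ (Structure.funMap f fun i => (xs i).out)
  RelMap _ _ := False

theorem realize_quotient {A : Type*} [L.Structure A] {θ : Setoid A} (hθ : IsCongruence L θ)
    {α : Type*} (t : L.Term α) (v : α → A) :
    t.realize (fun i => Quotient.mk θ (v i)) = Quotient.mk θ (t.realize v) := by
  induction t with
  | var i => rfl
  | func f ts ih =>
    simp only [Term.realize, ih]
    exact Quotient.sound (hθ _ f _ _ fun i => Quotient.mk_out _)

theorem out_mk_mem_iff {A : Type*} {θ : Setoid A} {F : Set A} (hθF : Compatible θ F) (a : A) :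
    (Quotient.mk θ a).out ∈ F ↔ a ∈ F :=
  ⟨hθF _ _ (Quotient.mk_out a), hθF _ _ (θ.symm (Quotient.mk_out a))⟩

/-- The quotient of a filter by a compatible congruence is a filter. -/
theorem IsFilter.quotient {Λ : Logic L} {A : Type*} [L.Structure A] {F : Set A}
    (hF : IsFilter Λ F) {θ : Setoid A} (hθ : IsCongruence L θ) (hθF : Compatible θ F) :
    IsFilter Λ {q : Quotient θ | q.out ∈ F} := by
  intro Γ φ hφ v hv
  obtain ⟨w, rfl⟩ : ∃ w : ℕ → A, v = fun i => Quotient.mk _ (w i) :=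
    ⟨fun i => (v i).out, by simp⟩
  simp only [realize_quotient hθ, Set.mem_ofPred_eq, out_mk_mem_iff hθF] at hv ⊢
  exact hF Γ φ hφ w hv

/-- The algebra of formulas, lifted to an arbitrary universe. -/
instance formulaAlgebra : L.Structure (ULift.{u} (L.Term ℕ)) where
  funMap f ts := ⟨Term.func f fun i => (ts i).down⟩
  RelMap _ _ := False

theorem realize_formulaAlgebra (t : L.Term ℕ) (v : ℕ → ULift.{u} (L.Term ℕ)) :
    t.realize v = ⟨t.subst fun i => (v i).down⟩ := by
  induction t with
  | var i => rfl
  | func f ts ih =>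
    simp only [Term.realize, ih]
    rfl

/-- The theories of a logic are filters on the algebra of formulas, by structurality. -/
theorem isFilter_theory (Λ : Logic L) (Γ : Set (L.Term ℕ)) :
    IsFilter Λ {t : ULift.{u} (L.Term ℕ) | t.down ∈ Λ.C Γ} := by
  intro Δ φ hφ v hv
  simp only [realize_formulaAlgebra, Set.mem_ofPred_eq] at hv ⊢
  have h := Λ.structural (fun i => (v i).down) Δ ⟨φ, hφ, rfl⟩
  refine Λ.C.le_closure_iff.1 (?_ : _ ≤ _) h
  rintro _ ⟨δ, hδ, rfl⟩
  exact hv δ hδ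

theorem IsEquivalential.isProtoalgebraic {Λ : Logic L} (h : IsEquivalential.{u} Λ) :
    IsProtoalgebraic.{u} Λ := by
  obtain ⟨ρ, hρ⟩ := h
  refine ⟨(fun φ => φ.relabel Sum.inl) '' ρ, fun A _ F hF a b => ?_⟩
  rw [hρ A F hF a b]
  constructor
  · rintro h c _ ⟨φ, hφ, rfl⟩
    simpa [Term.realize_relabel] using h φ hφ
  · intro h φ hφ
    simpa [Term.realize_relabel] using h (fun _ => a) _ ⟨φ, hφ, rfl⟩

theorem IsTruthEquational.truthImplicitlyDefinable {Λ : Logic L} (h : IsTruthEquational.{u} Λ) :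
    TruthImplicitlyDefinable.{u} Λ := by
  obtain ⟨τ, hτ⟩ := h
  intro A _ F G hF hG
  rw [hτ A F hF, hτ A G hG]

theorem IsProtoalgebraic.leibniz_mono {Λ : Logic L} (h : IsProtoalgebraic.{u} Λ)
    {A : Type u} [L.Structure A] {F G : Set A} (hF : IsFilter Λ F) (hG : IsFilter Λ G)
    (hFG : F ⊆ G) : leibniz L F ≤ leibniz L G := by
  obtain ⟨ρ, hρ⟩ := h
  intro a b hab
  exact (hρ A G hG a b).2 fun c φ hφ => hFG ((hρ A F hF a b).1 hab c φ hφ)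

end General

/-! ### Integer values of ring terms -/

theorem realize_intCast {R : Type*} [CommRing R] [Ring.CompatibleRing R] {α : Type*}
    (t : Language.ring.Term α) (a : α → ℤ) :
    letI := Ring.compatibleRingOfRing ℤ
    t.realize (fun i => (a i : R)) = ((t.realize a : ℤ) : R) := by
  let := Ring.compatibleRingOfRing ℤ
  induction t with
  | var i => rfl
  | func f ts ih =>
    simp only [Term.realize, ih]
    cases f <;> simp

/-- An algebra in which both sides of each pair of `crPairs` agree is a commutative ring, so that
it receives a homomorphism from `ℤ`. -/
theorem exists_realize_int {Q : Type*} [Language.ring.Structure Q]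
    (h : ∀ e ∈ crPairs, ∀ v : ℕ → Q, e.1.realize v = e.2.realize v) :
    letI := Ring.compatibleRingOfRing ℤ
    ∃ g : ℤ → Q, ∀ {α : Type} (t : Language.ring.Term α) (a : α → ℤ),
      t.realize (fun i => g (a i)) = g (t.realize a) := by
  let := Ring.addOfRingStructure Q
  let := Ring.mulOfRingStructure Q
  let := Ring.negOfRingStructure Q
  let := Ring.zeroOfRingStructure Q
  let := Ring.oneOfRingStructure Q
  let := Ring.compatibleRingOfRingStructure Q
  let val (x y z u w : Q) : ℕ → Q
    | 0 => x | 1 => y | 2 => z | 3 => u | _ => w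
  simp only [crPairs, Set.mem_insert_iff, Set.mem_singleton_iff, forall_eq_or_imp, forall_eq,
    Ring.realize_add, Ring.realize_mul, Ring.realize_neg, Ring.realize_zero, Ring.realize_one,
    Term.realize_var] at h
  obtain ⟨h1, h2, h3, h4, h5, h6, h7, h8, -, -, -, h12, h13⟩ := h
  have zero_add' (a : Q) : 0 + a = a := h12 (val a a a a a)
  -- the contexts `w + u * t` are instantiated by `w = 0` and `u = 1`
  have cancel {a b : Q} (e : 0 + 1 * a = 0 + 1 * b) : a = b := by
    have e1 : 0 + 1 * a = 0 + a := h13 (val 0 a a a a)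
    have e2 : 0 + 1 * b = 0 + b := h13 (val 0 b b b b)
    rwa [e1, e2, zero_add', zero_add'] at e
  have mul_comm' (a b : Q) : a * b = b * a := cancel (h2 (val a b a 1 0))
  have add_comm' (a b : Q) : a + b = b + a := cancel (h5 (val a b a 1 0))
  let : CommRing Q := CommRing.ofMinimalAxioms
    (fun a b c => cancel (h4 (val a b c 1 0)))
    zero_add'
    (fun a => (add_comm' _ _).trans (cancel (h7 (val a a a 1 0))))
    (fun a b c => cancel (h1 (val a b c 1 0)))
    mul_comm'
    (fun a => (mul_comm' _ _).trans (cancel (h3 (val a a a 1 0))))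
    (fun a b c => cancel (h8 (val a b c 1 0)))
  exact ⟨fun k => (k : Q), fun t a => realize_intCast t a⟩

/-! ### The biconditional in the filters of the logic of a Diophantine equation -/

/-- The interpretation of the symbol `↔` in an algebra. -/
def bicOp {A : Type*} [ringBicond.Structure A] (a b : A) : A :=
  Structure.funMap (L := ringBicond) (Sum.inr BicondFunc.bicond) ![a, b]

theorem realize_bic {A : Type*} [ringBicond.Structure A] {α : Type} (s t : ringBicond.Term α)
    (v : α → A) : (bic s t).realize v = bicOp (s.realize v) (t.realize v) :=
  Term.realize_functions_apply₂

theorem realize_tneg {A : Type*} [ringBicond.Structure A] {α : Type} (s : ringBicond.Term α)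
    (v : α → A) : (tneg s).realize v =
      Structure.funMap (L := ringBicond) (Sum.inl Ring.negFunc) ![s.realize v] :=
  Term.realize_functions_apply₁

theorem realize_tadd {A : Type*} [ringBicond.Structure A] {α : Type} (s t : ringBicond.Term α)
    (v : α → A) : (tadd s t).realize v =
      Structure.funMap (L := ringBicond) (Sum.inl Ring.addFunc) ![s.realize v, t.realize v] :=
  Term.realize_functions_apply₂

theorem realize_tmul {A : Type*} [ringBicond.Structure A] {α : Type} (s t : ringBicond.Term α)
    (v : α → A) : (tmul s t).realize v =
      Structure.funMap (L := ringBicond) (Sum.inl Ring.mulFunc) ![s.realize v, t.realize v] :=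
  Term.realize_functions_apply₂

/-- The valuation `x ↦ a`, `y ↦ b`, `z ↦ c` and `u ↦ d`. -/
def fourVal {A : Type*} (a b c d : A) : ℕ → A
  | 0 => a | 1 => b | 2 => c | _ => d

/-- The valuation `x ↦ a`, `y ↦ b` and `zᵢ ↦ cᵢ`, where `a` is the value of the remaining
variables. -/
def solutionVal {A : Type*} {n : ℕ} (a b : A) (c : Fin n → A) : ℕ → A
  | 0 => a
  | 1 => b
  | k + 2 => if h : k < n then c ⟨k, h⟩ else a

section Filter

variable {n : ℕ} {p : FirstOrder.Language.ring.Term (Fin n)} {A : Type*} [ringBicond.Structure A]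
  {F : Set A}

theorem realize_ofRing_relabel (v : ℕ → A) :
    (ofRing (p.relabel fun i : Fin n => (i : ℕ) + 2)).realize v =
      (ofRing p).realize fun i : Fin n => v (i + 2) := by
  let : Language.ring.Structure A :=
    (LHom.sumInl : Language.ring →ᴸ ringBicond).reduct A
  simp only [ofRing, LHom.realize_onTerm, Term.realize_relabel]
  rfl

theorem realize_ofRing_solutionVal (a b : A) (c : Fin n → A) :
    (ofRing (p.relabel fun i : Fin n => (i : ℕ) + 2)).realize (solutionVal a b c) =
      (ofRing p).realize c := by
  rw [realize_ofRing_relabel]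
  congr 1
  funext i
  simp [solutionVal]

theorem realize_ofRing_zero {α β : Type} (v : α → A) (w : β → A) :
    (ofRing 0 : ringBicond.Term α).realize v = (ofRing 0 : ringBicond.Term β).realize w := by
  let : Language.ring.Structure A :=
    (LHom.sumInl : Language.ring →ᴸ ringBicond).reduct A
  simp [ofRing, LHom.realize_onTerm, Ring.zero_def]

theorem bicOp_refl (hF : IsFilter (diophantineLogic p) F) (a : A) : bicOp a a ∈ F := by
  have := isFilter_logic_iff.1 hF ⟨∅, bic (Term.var 0) (Term.var 0)⟩
    (Or.inl (Or.inl (Or.inl rfl))) (fourVal a a a a) (by simp)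
  simpa [realize_bic, fourVal] using this

theorem bicOp_symm (hF : IsFilter (diophantineLogic p) F) {a b : A} (h : bicOp a b ∈ F) :
    bicOp b a ∈ F := by
  have := isFilter_logic_iff.1 hF
    ⟨{bic (Term.var 0) (Term.var 1)}, bic (Term.var 1) (Term.var 0)⟩
    (Or.inl (Or.inl (Or.inr (Or.inl rfl)))) (fourVal a b a a)
    (by simpa [realize_bic, fourVal] using h)
  simpa [realize_bic, fourVal] using this

theorem bicOp_trans (hF : IsFilter (diophantineLogic p) F) {a b c : A} (h₁ : bicOp a b ∈ F)
    (h₂ : bicOp b c ∈ F) : bicOp a c ∈ F := by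
  classical
  have := isFilter_logic_iff.1 hF
    ⟨{bic (Term.var 0) (Term.var 1), bic (Term.var 1) (Term.var 2)},
      bic (Term.var 0) (Term.var 2)⟩
    (Or.inl (Or.inl (Or.inr (Or.inr (Or.inl (by congr!)))))) (fourVal a b c a)
    (by simpa [realize_bic, fourVal] using ⟨h₁, h₂⟩)
  simpa [realize_bic, fourVal] using this

theorem bicOp_neg (hF : IsFilter (diophantineLogic p) F) {a b : A} (h : bicOp a b ∈ F) :
    bicOp (Structure.funMap (L := ringBicond) (Sum.inl Ring.negFunc) ![a])
      (Structure.funMap (L := ringBicond) (Sum.inl Ring.negFunc) ![b]) ∈ F := by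
  have := isFilter_logic_iff.1 hF
    ⟨{bic (Term.var 0) (Term.var 1)}, bic (tneg (Term.var 0)) (tneg (Term.var 1))⟩
    (Or.inl (Or.inl (Or.inr (Or.inr (Or.inr (Or.inl rfl)))))) (fourVal a b a a)
    (by simpa [realize_bic, fourVal] using h)
  simpa [realize_bic, realize_tneg, fourVal] using this

theorem bicOp_binary (hF : IsFilter (diophantineLogic p) F) (f : ringBicond.Functions 2)
    {a b c d : A} (h₁ : bicOp a b ∈ F) (h₂ : bicOp c d ∈ F) :
    bicOp (Structure.funMap f ![a, c]) (Structure.funMap f ![b, d]) ∈ F := by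
  classical
  have := isFilter_logic_iff.1 hF
    ⟨{bic (Term.var 0) (Term.var 1), bic (Term.var 2) (Term.var 3)},
      bic (f.apply₂ (Term.var 0) (Term.var 2)) (f.apply₂ (Term.var 1) (Term.var 3))⟩
    (by
      refine Or.inl (Or.inl (Or.inr (Or.inr (Or.inr (Or.inr ?_)))))
      rcases f with f | f
      · cases f
        · exact Or.inl (by congr!)
        · exact Or.inr (Or.inl (by congr!))
      · cases f
        exact Or.inr (Or.inr (Or.inl (by congr!)))) (fourVal a b c d)
    (by simpa [realize_bic, fourVal] using ⟨h₁, h₂⟩)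
  simpa [realize_bic, fourVal, Term.realize_functions_apply₂] using this

theorem mem_of_bicOp_mem (hF : IsFilter (diophantineLogic p) F) {c : Fin n → A}
    (hc : bicOp ((ofRing p).realize c) ((ofRing 0).realize c) ∈ F) {a b : A} (ha : a ∈ F)
    (h : bicOp a b ∈ F) : b ∈ F := by
  classical
  have := isFilter_logic_iff.1 hF
    ⟨{bic (ofRing (p.relabel fun i : Fin n => (i : ℕ) + 2)) (ofRing 0), Term.var 0,
      bic (Term.var 0) (Term.var 1)}, Term.var 1⟩
    (Or.inl (Or.inl (Or.inr (Or.inr (Or.inr (Or.inr (Or.inr (Or.inr (Or.inr (Or.inl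
      (by congr!))))))))))) (solutionVal a b c)
    (by
      rw [realize_ofRing_zero c (solutionVal a b c)] at hc
      simpa [realize_bic, realize_ofRing_solutionVal, hc, solutionVal] using ⟨ha, h⟩)
  simpa [solutionVal] using this

theorem bicOp_mem_of_mem (hF : IsFilter (diophantineLogic p) F) {c : Fin n → A}
    (hc : bicOp ((ofRing p).realize c) ((ofRing 0).realize c) ∈ F) {a b : A} (ha : a ∈ F)
    (hb : b ∈ F) : bicOp a b ∈ F := by
  classical
  have := isFilter_logic_iff.1 hF
    ⟨{bic (ofRing (p.relabel fun i : Fin n => (i : ℕ) + 2)) (ofRing 0), Term.var 0, Term.var 1},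
      bic (Term.var 0) (Term.var 1)⟩
    (Or.inl (Or.inl (Or.inr (Or.inr (Or.inr (Or.inr (Or.inr (Or.inr (Or.inr (Or.inr
      (by congr!))))))))))) (solutionVal a b c)
    (by
      rw [realize_ofRing_zero c (solutionVal a b c)] at hc
      simpa [realize_bic, realize_ofRing_solutionVal, hc, solutionVal] using ⟨ha, hb⟩)
  simpa [solutionVal, realize_bic] using this

/-- The relation `a ↔ b ∈ F`. -/
def bicCongruence (hF : IsFilter (diophantineLogic p) F) : Setoid A where
  r a b := bicOp a b ∈ F
  iseqv := ⟨bicOp_refl hF, bicOp_symm hF, bicOp_trans hF⟩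

theorem isCongruence_bicCongruence (hF : IsFilter (diophantineLogic p) F) :
    IsCongruence ringBicond (bicCongruence hF) := by
  have binary (f : ringBicond.Functions 2) (a b : Fin 2 → A)
      (h : ∀ i, bicCongruence hF (a i) (b i)) :
      bicCongruence hF (Structure.funMap f a) (Structure.funMap f b) := by
    have := bicOp_binary hF f (h 0) (h 1)
    rwa [← show a = ![a 0, a 1] from funext fun i => by fin_cases i <;> rfl,
      ← show b = ![b 0, b 1] from funext fun i => by fin_cases i <;> rfl] at this
  intro m f a b h
  rcases f with f | f
  · cases f with
    | add => exact binary _ a b h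
    | mul => exact binary _ a b h
    | neg =>
      have := bicOp_neg hF (h 0)
      rwa [← show a = ![a 0] from funext fun i => by fin_cases i; rfl,
        ← show b = ![b 0] from funext fun i => by fin_cases i; rfl] at this
    | zero => rw [Subsingleton.elim a b]
    | one => rw [Subsingleton.elim a b]
  · cases f
    exact binary _ a b h

theorem bicOp_mem_of_leibniz (hF : IsFilter (diophantineLogic p) F) {a b : A}
    (h : leibniz ringBicond F a b) : bicOp a b ∈ F := by
  obtain ⟨hc, hF'⟩ := (leibniz_isGreatest ringBicond F).1
  refine hF' (bicOp a a) (bicOp a b) (hc 2 _ _ _ fun i => ?_) (bicOp_refl hF a)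
  fin_cases i
  · exact (leibniz ringBicond F).refl a
  · exact h

/-- An integer solution of `p ≈ 0` gives a solution in the commutative ring obtained by factoring
by `x ↔ y`, for every model of the logic. -/
theorem exists_solution_mem (hp : HasIntegerSolution p) (hF : IsFilter (diophantineLogic p) F) :
    ∃ c : Fin n → A, bicOp ((ofRing p).realize c) ((ofRing 0).realize c) ∈ F := by
  obtain ⟨k, hk⟩ := hp
  let : Language.ring.Structure (Quotient (bicCongruence hF)) :=
    (LHom.sumInl : Language.ring →ᴸ ringBicond).reduct _
  have hcr : ∀ e ∈ crPairs, ∀ v : ℕ → Quotient (bicCongruence hF),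
      e.1.realize v = e.2.realize v := by
    intro e he v
    obtain ⟨w, rfl⟩ : ∃ w : ℕ → A, v = fun i => Quotient.mk _ (w i) :=
      ⟨fun i => (v i).out, by simp⟩
    have := isFilter_logic_iff.1 hF ⟨∅, bic (ofRing e.1) (ofRing e.2)⟩
      (Or.inr ⟨e, he, rfl⟩) w (by simp)
    rw [realize_bic] at this
    have key := Quotient.sound (s := bicCongruence hF) this
    rw [← realize_quotient (isCongruence_bicCongruence hF),
      ← realize_quotient (isCongruence_bicCongruence hF)] at key
    simpa only [ofRing, LHom.realize_onTerm] using key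
  obtain ⟨g, hg⟩ := exists_realize_int hcr
  refine ⟨fun i => (g (k i)).out, Quotient.exact (s := bicCongruence hF) ?_⟩
  rw [← realize_quotient (isCongruence_bicCongruence hF),
    ← realize_quotient (isCongruence_bicCongruence hF)]
  simp only [ofRing, LHom.realize_onTerm, Quotient.out_eq]
  rw [hg, hg, hk]
  let := Ring.compatibleRingOfRing ℤ
  rw [Ring.realize_zero]

theorem compatible_bicCongruence (hp : HasIntegerSolution p)
    (hF : IsFilter (diophantineLogic p) F) : Compatible (bicCongruence hF) F := by
  obtain ⟨c, hc⟩ := exists_solution_mem hp hF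
  exact fun a b h ha => mem_of_bicOp_mem hF hc ha h

theorem leibniz_iff_bicOp_mem (hp : HasIntegerSolution p) (hF : IsFilter (diophantineLogic p) F)
    (a b : A) : leibniz ringBicond F a b ↔ bicOp a b ∈ F :=
  ⟨bicOp_mem_of_leibniz hF, fun h => (leibniz_isGreatest ringBicond F).2
    ⟨isCongruence_bicCongruence hF, compatible_bicCongruence hp hF⟩ h⟩

/-- In a matrix where `x ↔ y` defines equality, the filter is the singleton of the value of
`x ↔ x`. -/
theorem mem_iff_eq_bicOp_self (hp : HasIntegerSolution p) (hF : IsFilter (diophantineLogic p) F)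
    (hred : ∀ a b : A, bicOp a b ∈ F → a = b) (a b : A) : a ∈ F ↔ a = bicOp b b := by
  obtain ⟨c, hc⟩ := exists_solution_mem hp hF
  refine ⟨fun ha => hred _ _ (bicOp_mem_of_mem hF hc ha (bicOp_refl hF b)), ?_⟩
  rintro rfl
  exact bicOp_refl hF b

end Filter

/-! ### Solvable equations -/

theorem isCongruenceFormulas_bic {n : ℕ} {p : FirstOrder.Language.ring.Term (Fin n)}
    (hp : HasIntegerSolution p) :
    IsCongruenceFormulas.{u} (diophantineLogic p) {bic (Term.var 0) (Term.var 1)} := by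
  intro A _ F hF a b
  simp [leibniz_iff_bicOp_mem hp hF, realize_bic]

theorem isTruthEquational_of_hasIntegerSolution {n : ℕ}
    {p : FirstOrder.Language.ring.Term (Fin n)} (hp : HasIntegerSolution p) :
    IsTruthEquational.{u} (diophantineLogic p) := by
  refine ⟨{(Term.var (), bic (Term.var ()) (Term.var ()))}, fun A _ F hF => ?_⟩
  ext a
  have hred (a b : A) (h : bicOp a b ∈ F) : a = b := by
    have := (leibniz_iff_bicOp_mem hp hF.1 a b).2 h
    rwa [hF.2] at this
  simp [mem_iff_eq_bicOp_self hp hF.1 hred a a, realize_bic]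

theorem bicOp_quotient {A : Type*} [ringBicond.Structure A] {θ : Setoid A}
    (hθ : IsCongruence ringBicond θ) (a b : A) :
    bicOp (Quotient.mk θ a) (Quotient.mk θ b) = Quotient.mk θ (bicOp a b) := by
  have h := realize_quotient hθ (bic (Term.var 0) (Term.var 1)) ![a, b]
  simpa [realize_bic] using h

/-- The logic of a solvable equation is the assertional logic, for the constant `x ↔ x`, of the
class of algebras with a filter for which `x ↔ y` defines equality. -/
theorem isAssertional_of_hasIntegerSolution {n : ℕ} {p : FirstOrder.Language.ring.Term (Fin n)}
    (hp : HasIntegerSolution p) : IsAssertional.{u} (diophantineLogic p) := by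
  refine ⟨{A | ∃ F : Set A.α, IsFilter (diophantineLogic p) F ∧
      ∀ a b : A.α, bicOp a b ∈ F → a = b}, bic (Term.var 0) (Term.var 0), ?_, fun Γ φ => ?_⟩
  · rintro A ⟨F, hF, hred⟩ v w
    rw [realize_bic, realize_bic]
    exact (mem_iff_eq_bicOp_self hp hF hred _ _).1 (bicOp_refl hF _)
  constructor
  · rintro hφ A ⟨F, hF, hred⟩ v hv
    simp only [realize_bic, ← mem_iff_eq_bicOp_self hp hF hred] at hv ⊢
    exact hF Γ φ hφ v hv
  · intro h
    -- completeness: the algebra of formulas modulo interderivability from `Γ`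
    have hF := isFilter_theory.{u} (diophantineLogic p) Γ
    have hθ := isCongruence_bicCongruence hF
    have hθF := compatible_bicCongruence hp hF
    set F := {t : ULift.{u} (ringBicond.Term ℕ) | t.down ∈ (diophantineLogic p).C Γ}
    have hred (a b : Quotient (bicCongruence hF))
        (hab : bicOp a b ∈ {q : Quotient (bicCongruence hF) | q.out ∈ F}) : a = b := by
      induction a using Quotient.ind with | _ a
      induction b using Quotient.ind with | _ b
      rw [bicOp_quotient hθ, Set.mem_ofPred_eq, out_mk_mem_iff hθF] at hab
      exact Quotient.sound hab
    have hQ := hF.quotient hθ hθF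
    have realize_mem (t : ringBicond.Term ℕ) :
        t.realize (fun i => Quotient.mk (bicCongruence hF) ⟨Term.var i⟩) ∈
          {q : Quotient (bicCongruence hF) | q.out ∈ F} ↔ t ∈ (diophantineLogic p).C Γ := by
      rw [realize_quotient hθ, Set.mem_ofPred_eq, out_mk_mem_iff hθF, realize_formulaAlgebra]
      exact iff_of_eq (congrArg (· ∈ (diophantineLogic p).C Γ) (subst_var t))
    have key := h ⟨Quotient (bicCongruence hF), inferInstance⟩ ⟨_, hQ, hred⟩
      fun i => Quotient.mk (bicCongruence hF) ⟨Term.var i⟩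
    simp only [realize_bic] at key
    rw [← realize_mem, mem_iff_eq_bicOp_self hp hQ hred]
    refine key fun γ hγ => ?_
    rw [← mem_iff_eq_bicOp_self hp hQ hred, realize_mem]
    exact (diophantineLogic p).C.le_closure Γ hγ

theorem isFinitelyRegularlyAlgebraizable_of_hasIntegerSolution {n : ℕ}
    {p : FirstOrder.Language.ring.Term (Fin n)} (hp : HasIntegerSolution p) :
    IsFinitelyRegularlyAlgebraizable.{u} (diophantineLogic p) :=
  ⟨⟨isAssertional_of_hasIntegerSolution hp, ⟨_, isCongruenceFormulas_bic hp⟩,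
    isTruthEquational_of_hasIntegerSolution hp⟩, _, Set.finite_singleton _,
    isCongruenceFormulas_bic hp⟩

/-! ### Unsolvable equations -/

/-- The set `ℤ × B`, as the carrier of the algebra of `intProdAlgebra`. -/
def IntProd (B : Type u) : Type u := ℤ × B

open Classical in
/-- All operations are computed on the first coordinates, and the value of `a ↔ b` has first
coordinate `0` if the first coordinates of `a` and `b` agree, and `1` otherwise. The second
coordinate of all values is the default element of `B`. -/
noncomputable instance intProdAlgebra (B : Type u) [Inhabited B] :
    ringBicond.Structure (IntProd B) where
  funMap {n} f :=
    match n, f with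
    | _, Sum.inl f => fun xs =>
      ((Ring.compatibleRingOfRing ℤ).toStructure.funMap f fun i => (xs i).1, default)
    | _, Sum.inr BicondFunc.bicond => fun xs =>
      (if (xs 0).1 = (xs 1).1 then 0 else 1, default)
  RelMap _ _ := False

section IntProd

variable {B : Type u} [Inhabited B]

theorem bicOp_intProd_of_eq {a b : IntProd B} (h : a.1 = b.1) :
    bicOp a b = ((0, default) : ℤ × B) := by
  change ((if a.1 = b.1 then 0 else 1, default) : ℤ × B) = _
  rw [if_pos h]

theorem bicOp_intProd_of_ne {a b : IntProd B} (h : a.1 ≠ b.1) :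
    bicOp a b = ((1, default) : ℤ × B) := by
  change ((if a.1 = b.1 then 0 else 1, default) : ℤ × B) = _
  rw [if_neg h]

theorem funMap_intProd_congr {m : ℕ} (f : ringBicond.Functions m) {a b : Fin m → IntProd B}
    (h : ∀ i, (a i).1 = (b i).1) : Structure.funMap f a = Structure.funMap f b := by
  rcases f with f | f
  · change ((_, default) : ℤ × B) = (_, default)
    simp only [h]
  · cases f
    change ((if (a 0).1 = (a 1).1 then 0 else 1, default) : ℤ × B) =
      (if (b 0).1 = (b 1).1 then 0 else 1, default)
    simp only [h]

theorem realize_ofRing_intProd {α : Type} (t : FirstOrder.Language.ring.Term α)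
    (v : α → IntProd B) :
    letI := Ring.compatibleRingOfRing ℤ
    ((ofRing t).realize v).1 = t.realize fun i => (v i).1 := by
  let := Ring.compatibleRingOfRing ℤ
  induction t with
  | var i => rfl
  | func f ts ih =>
    simp only [Term.realize, ← ih]
    rfl

/-- If `p ≈ 0` has no integer solution, then the rules with premise `p ↔ 0` hold vacuously in
`IntProd B`. -/
theorem isFilter_intProd {n : ℕ} {p : FirstOrder.Language.ring.Term (Fin n)}
    (hp : ¬ HasIntegerSolution p) {F : Set (IntProd B)} (h0 : ((0, default) : ℤ × B) ∈ F)
    (h1 : ((1, default) : ℤ × B) ∉ F) : IsFilter (diophantineLogic p) F := by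
  classical
  let := Ring.compatibleRingOfRing ℤ
  have mem_iff (a b : IntProd B) : bicOp a b ∈ F ↔ a.1 = b.1 := by
    by_cases h : a.1 = b.1
    · rw [bicOp_intProd_of_eq h]; exact iff_of_true h0 h
    · rw [bicOp_intProd_of_ne h]; exact iff_of_false h1 h
  have congr₂ (f : ringBicond.Functions 2) {a b c d : IntProd B} (h : a.1 = b.1)
      (h' : c.1 = d.1) : (Structure.funMap f ![a, c]).1 = (Structure.funMap f ![b, d]).1 :=
    congrArg Prod.fst (funMap_intProd_congr f fun i => by fin_cases i <;> assumption)
  have unsolved (v : ℕ → IntProd B) :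
      (bic (ofRing (p.relabel fun i : Fin n => (i : ℕ) + 2)) (ofRing 0)).realize v ∉ F := by
    rw [realize_bic, mem_iff, realize_ofRing_relabel, realize_ofRing_intProd,
      realize_ofRing_intProd, Ring.realize_zero]
    exact fun h => hp ⟨_, h⟩
  refine isFilter_logic_iff.2 fun r hr v hv => ?_
  have vacuous (h : bic (ofRing (p.relabel fun i : Fin n => (i : ℕ) + 2)) (ofRing 0) ∈
      r.premises) : r.conclusion.realize v ∈ F := absurd (hv _ h) (unsolved v)
  rcases hr with (hr | hr) | ⟨e, he, rfl⟩
  · rcases hr with rfl | rfl | rfl | rfl | rfl | rfl | rfl | rfl | rfl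
    · simp [realize_bic, mem_iff]
    · simpa [realize_bic, mem_iff, eq_comm] using hv
    · simp only [Finset.mem_insert, Finset.mem_singleton, forall_eq_or_imp, forall_eq,
        realize_bic, mem_iff] at hv ⊢
      exact hv.1.trans hv.2
    · simp only [Finset.mem_singleton, forall_eq, realize_bic, mem_iff] at hv ⊢
      simp only [realize_tneg]
      exact congrArg Prod.fst (funMap_intProd_congr _ fun i => by fin_cases i; exact hv)
    -- the congruence rules for `+`, `·` and `↔`
    iterate 3
      simp only [Finset.mem_insert, Finset.mem_singleton, forall_eq_or_imp, forall_eq,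
        realize_bic, mem_iff] at hv ⊢
      try simp only [realize_tadd, realize_tmul]
      exact congr₂ _ hv.1 hv.2
    · exact vacuous (by simp)
    · exact vacuous (by simp)
  · rcases hr with ⟨φ, -, rfl⟩ | ⟨φ, -, rfl⟩ <;> exact vacuous (by simp)
  · simp only [realize_bic, mem_iff, realize_ofRing_intProd]
    simp only [crPairs, Set.mem_insert_iff, Set.mem_singleton_iff] at he
    rcases he with rfl | rfl | rfl | rfl | rfl | rfl | rfl | rfl | rfl | rfl | rfl | rfl | rfl <;>
      simp only [Ring.realize_add, Ring.realize_mul, Ring.realize_neg, Ring.realize_zero,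
        Ring.realize_one] <;> ring

/-- The equivalence of pairs with the same first coordinate is below the Leibniz congruence of any
union of its classes. -/
theorem leibniz_intProd {F : Set (IntProd B)}
    (hF : ∀ a b : IntProd B, a.1 = b.1 → a ∈ F → b ∈ F) {a b : IntProd B} (h : a.1 = b.1) :
    leibniz ringBicond F a b := by
  have hker : Setoid.ker (Prod.fst : ℤ × B → ℤ) ∈
      {θ : Setoid (IntProd B) | IsCongruence ringBicond θ ∧ Compatible θ F} :=
    ⟨fun m f a b hab => congrArg Prod.fst (funMap_intProd_congr f hab), hF⟩
  exact (leibniz_isGreatest ringBicond F).2 hker h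

end IntProd

theorem not_truthImplicitlyDefinable {n : ℕ} {p : FirstOrder.Language.ring.Term (Fin n)}
    (hp : ¬ HasIntegerSolution p) : ¬ TruthImplicitlyDefinable.{u} (diophantineLogic p) := by
  intro h
  have reduced {F : Set (IntProd PUnit.{u + 1})}
      (h0 : ((0, default) : ℤ × PUnit.{u + 1}) ∈ F)
      (h1 : ((1, default) : ℤ × PUnit.{u + 1}) ∉ F) :
      IsReducedModel (diophantineLogic p) F := by
    have hF := isFilter_intProd hp h0 h1
    refine ⟨hF, le_bot_iff.1 fun a b hab => ?_⟩
    by_contra hne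
    have hne' : a.1 ≠ b.1 := fun e => hne (Prod.ext e rfl)
    have := bicOp_mem_of_leibniz hF hab
    rw [bicOp_intProd_of_ne hne'] at this
    exact h1 this
  have key := h (IntProd PUnit.{u + 1}) {a | a.1 = 0} {a | a.1 = 0 ∨ a.1 = 2}
    (reduced rfl Int.one_ne_zero)
    (reduced (Or.inl rfl) (not_or.2 ⟨Int.one_ne_zero, (by decide : (1 : ℤ) ≠ 2)⟩))
  have mem : ((2, default) : ℤ × PUnit.{u + 1}) ∈
      {a : IntProd PUnit.{u + 1} | a.1 = 0 ∨ a.1 = 2} := Or.inr rfl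
  rw [← key] at mem
  exact absurd (show (2 : ℤ) = 0 from mem) (by decide)

theorem not_isProtoalgebraic {n : ℕ} {p : FirstOrder.Language.ring.Term (Fin n)}
    (hp : ¬ HasIntegerSolution p) : ¬ IsProtoalgebraic.{u} (diophantineLogic p) := by
  intro h
  let B := ULift.{u} Bool
  let F : Set (IntProd B) := {a | a.1 = 0}
  let G : Set (IntProd B) := {a | a.1 = 0 ∨ a = ((2, ⟨true⟩) : ℤ × B)}
  have hF : IsFilter (diophantineLogic p) F := isFilter_intProd hp rfl Int.one_ne_zero
  have hG : IsFilter (diophantineLogic p) G :=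
    isFilter_intProd hp (Or.inl rfl)
      (not_or.2 ⟨Int.one_ne_zero, fun e => absurd (congrArg Prod.fst e : (1 : ℤ) = 2) (by decide)⟩)
  have key := h.leibniz_mono hF hG (fun a ha => Or.inl ha)
    (leibniz_intProd (a := ((2, ⟨true⟩) : ℤ × B)) (b := ((2, ⟨false⟩) : ℤ × B))
      (fun a b hab (ha : a.1 = 0) => (hab.symm.trans ha : b.1 = 0)) rfl)
  have mem := (leibniz_isGreatest ringBicond G).1.2 _ _ key (Or.inr rfl)
  rcases mem with h | h
  · exact absurd (show (2 : ℤ) = 0 from h) (by decide)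
  · exact absurd (congrArg (fun a : ℤ × B => a.2.down) h : false = true) (by decide)

end AAL

theorem theorem4p7 (n : ℕ) (p : FirstOrder.Language.ring.Term (Fin n)) :
    List.TFAE
      [AAL.IsFinitelyRegularlyAlgebraizable.{u} (AAL.diophantineLogic p),
       AAL.TruthImplicitlyDefinable.{u} (AAL.diophantineLogic p),
       AAL.IsProtoalgebraic.{u} (AAL.diophantineLogic p),
       AAL.HasIntegerSolution p] := by
  tfae_have 1 → 2 := fun h => h.1.2.2.truthImplicitlyDefinable
  tfae_have 1 → 3 := fun h => h.1.2.1.isProtoalgebraic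
  tfae_have 2 → 4 := fun h => by_contra fun hp => AAL.not_truthImplicitlyDefinable hp h
  tfae_have 3 → 4 := fun h => by_contra fun hp => AAL.not_isProtoalgebraic hp h
  tfae_have 4 → 1 := AAL.isFinitelyRegularlyAlgebraizable_of_hasIntegerSolution
  tfae_finish
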